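/- A reverse Kreweras walk of length $n$ is a sequence $w_1,\dots,w_n$ of steps from $\mathcal Y=\{N,E,SW\}=\{(0,1),(1,0),(-1,-1)\}$ such that every partial sum $w_1+\cdots+w_k$ $(0\le k\le n)$ lies in the quadrant $\{(i,j): i\ge 0,\ j\ge 0\}$; it ends at $w_1+\cdots+w_n$. Let $$Q_6(x,y;t)=\sum_{i,j,n\ge 0} a_{ij}(n)\,x^iy^jt^n\in\mathbb Q[[x,y,t]]$$ be the complete generating series, where $a_{ij}(n)$ is the number of reverse Kreweras walks of length $n$ ending at $(i,j)$. Then, in the field of fractions of $\mathbb Q[[x,y,t]]$, $$Q_6(x,y;t)=\frac{xy-S(x,t)-S(y,t)}{xy-t(x^2y+xy^2+1)},\qquad S(u,t)=t\Bigl(Q_6(u,0;t)-\tfrac12 Q_6(0,0;t)\Bigr),$$ where the series $Q_6(u,0;t)$, for $u=x$ and $u=y$, is given by $$2Q_6(u,0;t)=Q_6(0,0;t)+\left(\frac{-2u}{Tt}\Bigl(1-\frac{T^2}{2u}\Bigr)+\frac1{tu}\right)\sqrt{U(u)}+\Bigl(1-tu-\frac{t}{u^2}\Bigr)\frac{u}{t^2},\qquad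 Q_6(0,0;t)=\frac{4T-T^4}{8t}.$$ Here $T=T(t)\in\mathbb Q[[t]]$ is the unique power series with $T=t(2+T^3)$, $U(u)=1-uT(1+T^3/4)+u^2T^2/4$, and $\sqrt{U(u)}$ is the unique power series with constant term $1$ whose square is $U(u)$. In particular $Q_6(x,y;t)$ is algebraic: $P(x,y,t,Q_6(x,y;t))=0$ for some nonzero polynomial $P$ with rational coefficients. -/

import Mathlib

noncomputable section

namespace QuarterWalk

/-- `w = w₁ ⋯ wₙ` is a walk in the quarter plane with steps in `Y`: all steps lie in `Y`, and
every partial sum `w₁ + ⋯ + w_k` (`0 ≤ k ≤ n`) lies in the first quadrant. -/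
def IsWalk (Y : Finset (ℤ × ℤ)) (w : List (ℤ × ℤ)) : Prop :=
  (∀ s ∈ w, s ∈ Y) ∧ ∀ p : List (ℤ × ℤ), p <+: w → 0 ≤ p.sum.1 ∧ 0 ≤ p.sum.2

/-- The number of quarter plane walks of length `n` with steps in `Y` that start at the origin
and end at `(i, j)` (a finite set, since `Y` is finite). -/
def walkCount (Y : Finset (ℤ × ℤ)) (i j n : ℕ) : ℕ :=
  Set.ncard {w : List (ℤ × ℤ) | IsWalk Y w ∧ w.length = n ∧ w.sum = ((i : ℤ), (j : ℤ))}

/-- Formal power series over `ℚ` in `x`, `y`, `t`, the variables number `0`, `1`, `2`. -/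
abbrev Ser : Type := MvPowerSeries (Fin 3) ℚ

/-- The field of fractions of `ℚ⟦x, y, t⟧`, in which the closed formulas are read. -/
abbrev SerFrac : Type := FractionRing Ser

/-- The embedding of `ℚ⟦x, y, t⟧` into its field of fractions. -/
def ι : Ser →+* SerFrac := algebraMap Ser SerFrac

def x : Ser := MvPowerSeries.X 0
def y : Ser := MvPowerSeries.X 1
def t : Ser := MvPowerSeries.X 2

/-- The complete generating function `Q_Y(x, y; t)`: the coefficient of `x ^ i * y ^ j * t ^ n`
is the number of walks of length `n` ending at `(i, j)`. -/
def completeGF (Y : Finset (ℤ × ℤ)) : Ser :=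
  fun m => (walkCount Y (m 0) (m 1) (m 2) : ℚ)

/-- The step set `{N, E, SW}` of the reverse Kreweras walks. -/
def revKreweras : Finset (ℤ × ℤ) := {(0, 1), (1, 0), (-1, -1)}

/-- The complete generating function of the reverse Kreweras walks. -/
def Q : Ser := completeGF revKreweras

/-- The specialization `Q(a, b; t)`. -/
def Qat (a b : Ser) : Ser := MvPowerSeries.subst ![a, b, t] Q

/-- The substitution in `Qat` is legitimate for series `a`, `b` without constant term. -/
theorem hasSubst_Qat (a b : Ser) (ha : MvPowerSeries.constantCoeff a = 0)
    (hb : MvPowerSeries.constantCoeff b = 0) :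
    MvPowerSeries.HasSubst (![a, b, t] : Fin 3 → Ser) := by
  apply MvPowerSeries.hasSubst_of_constantCoeff_zero
  intro s
  fin_cases s
  · simpa using ha
  · simpa using hb
  · simp [t]

/-- `S(u, t) = t * (Q(u, 0; t) - Q(0, 0; t) / 2)`. -/
def S (u : Ser) : Ser := t * (Qat u 0 - (1 / 2 : ℚ) • Qat 0 0)

/-- A power series in `t` alone, as a series in `x`, `y`, `t`. -/
def inT (T : PowerSeries ℚ) : Ser := PowerSeries.subst t T

/-- `U(u) = 1 - u T (1 + T ^ 3 / 4) + u ^ 2 T ^ 2 / 4`. -/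
def U (T : PowerSeries ℚ) (u : Ser) : Ser :=
  1 - u * inT T * (1 + (1 / 4 : ℚ) • inT T ^ 3) + (1 / 4 : ℚ) • (u ^ 2 * inT T ^ 2)

/-- `V` is the square root of `f` with constant term `1`. -/
def IsSqrt (f V : Ser) : Prop := V ^ 2 = f ∧ MvPowerSeries.constantCoeff V = 1

/-- The right-hand side of the closed formula for `2 * Q(u, 0; t)`, in a field, where `T` stands
for the series `T(t)`, `V` for the square root of `U(u)` and `q` for `Q(0, 0; t)`. -/
def axisExpr {K : Type*} [Field K] (u t T V q : K) : K :=
  q + (-2 * u / (T * t) * (1 - T ^ 2 / (2 * u)) + 1 / (t * u)) * V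
    + (1 - t * u - t / u ^ 2) * (u / t ^ 2)

end QuarterWalk

end

open QuarterWalk

noncomputable section

namespace QuarterWalk

/-! Removing the last step of a walk gives the kernel equation `kernel * Q = x * y - t * boundary Q`
(`kernel_mul_Q`), which determines `Q` (`boundary_unique`). So it suffices to exhibit a solution
built from a closed form `axisSeries` for the axis values. The crux is `kernel_dvd`: the kernel
divides `4xy - T(A(x) + A(y))`. The kernel is prime, because an automorphism of the power series
ring sends `t` to it. Up to factors prime to the kernel, the expression is congruent to a sum of two
terms, one with `√U(x)` and one with `√U(y)`. The product of this sum with the corresponding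
difference contains no radical and is a multiple of the kernel, and a specialization shows that the
kernel does not divide the difference. The quotient `G` takes the right values on the axes, hence
equals `4 * Q`; the explicit formulas and algebraicity follow. -/

/-! ### Counting walks by their last step -/

/-- The walks of length `n` with steps in `Y` from the origin to `p`. -/
def walksTo (Y : Finset (ℤ × ℤ)) (p : ℤ × ℤ) (n : ℕ) : Set (List (ℤ × ℤ)) :=
  {w | IsWalk Y w ∧ w.length = n ∧ w.sum = p}

theorem isWalk_append_singleton {Y : Finset (ℤ × ℤ)} {w : List (ℤ × ℤ)} {s : ℤ × ℤ} :
    IsWalk Y (w ++ [s]) ↔ IsWalk Y w ∧ s ∈ Y ∧ 0 ≤ (w.sum + s).1 ∧ 0 ≤ (w.sum + s).2 := by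
  simp only [IsWalk, List.prefix_concat_iff, List.mem_append, List.mem_singleton]
  constructor
  · rintro ⟨h₁, h₂⟩
    refine ⟨⟨fun a ha => h₁ a (Or.inl ha), fun p hp => h₂ p (Or.inr hp)⟩, h₁ s (Or.inr rfl), ?_⟩
    simpa using h₂ _ (Or.inl rfl)
  · rintro ⟨⟨h₁, h₂⟩, hs, hq⟩
    refine ⟨?_, ?_⟩
    · rintro a (ha | rfl)
      exacts [h₁ a ha, hs]
    · rintro p (rfl | hp)
      exacts [by simpa using hq, h₂ p hp]

theorem walksTo_eq_empty {Y : Finset (ℤ × ℤ)} {p : ℤ × ℤ} (n : ℕ) (hp : ¬ (0 ≤ p.1 ∧ 0 ≤ p.2)) :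
    walksTo Y p n = ∅ := by
  ext w
  simp only [walksTo, Set.mem_ofPred_eq, Set.mem_empty_iff_false, iff_false]
  rintro ⟨⟨-, h⟩, -, rfl⟩
  exact hp (h w (List.prefix_refl w))

theorem walksTo_succ {Y : Finset (ℤ × ℤ)} {p : ℤ × ℤ} (n : ℕ) (hp : 0 ≤ p.1 ∧ 0 ≤ p.2) :
    walksTo Y p (n + 1) = ⋃ s ∈ Y, (fun w => w ++ [s]) '' walksTo Y (p - s) n := by
  ext w
  simp only [Set.mem_iUnion, Set.mem_image, walksTo, Set.mem_ofPred_eq, exists_prop]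
  constructor
  · rintro ⟨h, hl, hs⟩
    rcases List.eq_nil_or_concat' w with rfl | ⟨v, s, rfl⟩
    · simp at hl
    · rw [isWalk_append_singleton] at h
      refine ⟨s, h.2.1, v, ⟨h.1, by simpa using hl, ?_⟩, rfl⟩
      rw [← hs]
      simp
  · rintro ⟨s, hs, v, ⟨hv, hl, hsum⟩, rfl⟩
    have : v.sum + s = p := by rw [hsum]; abel
    exact ⟨isWalk_append_singleton.2 ⟨hv, hs, by rw [this]; exact hp⟩, by simp [hl],
      by simpa using this⟩

theorem walksTo_zero {Y : Finset (ℤ × ℤ)} (p : ℤ × ℤ) :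
    walksTo Y p 0 = if p = 0 then {[]} else ∅ := by
  ext w
  simp only [walksTo, Set.mem_ofPred_eq, List.length_eq_zero_iff]
  split_ifs with h
  · subst h
    simp only [Set.mem_singleton_iff]
    exact ⟨fun h => h.2.1, by rintro rfl; simp [IsWalk]⟩
  · simp only [Set.mem_empty_iff_false, iff_false]
    rintro ⟨-, rfl, h'⟩
    exact h (by simpa using h'.symm)

theorem walksTo_finite {Y : Finset (ℤ × ℤ)} (n : ℕ) : ∀ p, (walksTo Y p n).Finite := by
  induction n with
  | zero =>
    intro p
    rw [walksTo_zero]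
    split_ifs
    exacts [Set.finite_singleton _, Set.finite_empty]
  | succ n ih =>
    intro p
    by_cases hp : 0 ≤ p.1 ∧ 0 ≤ p.2
    · rw [walksTo_succ n hp]
      exact Y.finite_toSet.biUnion fun s _ => (ih _).image _
    · rw [walksTo_eq_empty _ hp]
      exact Set.finite_empty

theorem ncard_walksTo_succ {Y : Finset (ℤ × ℤ)} {p : ℤ × ℤ} (n : ℕ) (hp : 0 ≤ p.1 ∧ 0 ≤ p.2) :
    (walksTo Y p (n + 1)).ncard = ∑ s ∈ Y, (walksTo Y (p - s) n).ncard := by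
  classical
  have key : ∀ Z : Finset (ℤ × ℤ),
      (⋃ s ∈ Z, (fun w => w ++ [s]) '' walksTo Y (p - s) n).ncard
        = ∑ s ∈ Z, (walksTo Y (p - s) n).ncard := by
    intro Z
    induction Z using Finset.induction_on with
    | empty => simp
    | insert a Z ha ih =>
      have hfin : (⋃ s ∈ Z, (fun w => w ++ [s]) '' walksTo Y (p - s) n).Finite :=
        Z.finite_toSet.biUnion fun s _ => (walksTo_finite n _).image _
      rw [Finset.set_biUnion_insert, Finset.sum_insert ha, ← ih, Set.ncard_union_eq ?_ ((walksTo_finite n _).image _) hfin,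
        Set.ncard_image_of_injective _ (List.append_left_injective [a])]
      -- Walks with different last steps are different, so the union is disjoint.
      · rw [Set.disjoint_left]
        rintro w ⟨v, -, rfl⟩ hw
        simp only [Set.mem_iUnion, Set.mem_image] at hw
        obtain ⟨s, hs, v', -, h⟩ := hw
        have := (List.append_inj' h rfl).2
        simp only [List.cons.injEq, and_true] at this
        exact ha (this ▸ hs)
  rw [walksTo_succ n hp, key]

/-- The number of reverse Kreweras walks of length `n` ending at `p`. -/
def endCount (p : ℤ × ℤ) (n : ℕ) : ℕ := (walksTo revKreweras p n).ncard

theorem endCount_of_neg {p : ℤ × ℤ} (n : ℕ) (hp : ¬ (0 ≤ p.1 ∧ 0 ≤ p.2)) : endCount p n = 0 := by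
  rw [endCount, walksTo_eq_empty n hp, Set.ncard_empty]

theorem endCount_zero (p : ℤ × ℤ) : endCount p 0 = if p = 0 then 1 else 0 := by
  rw [endCount, walksTo_zero]
  split_ifs <;> simp

theorem endCount_succ {i j : ℤ} (n : ℕ) (hi : 0 ≤ i) (hj : 0 ≤ j) :
    endCount (i, j) (n + 1)
      = endCount (i, j - 1) n + endCount (i - 1, j) n + endCount (i + 1, j + 1) n := by
  rw [endCount, ncard_walksTo_succ n ⟨hi, hj⟩, revKreweras, Finset.sum_insert (by decide),
    Finset.sum_insert (by decide), Finset.sum_singleton]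
  simp [endCount, revKreweras, add_assoc]

theorem coeff_Q (m : Fin 3 →₀ ℕ) :
    MvPowerSeries.coeff m Q = (endCount ((m 0 : ℤ), (m 1 : ℤ)) (m 2) : ℚ) := rfl

/-! ### Coefficients, rescalings and the kernel equation -/

/-- The exponent of the monomial `x ^ i * y ^ j * t ^ n`. -/
def expo (i j n : ℕ) : Fin 3 →₀ ℕ := Finsupp.equivFunOnFinite.symm ![i, j, n]

theorem exists_expo (m : Fin 3 →₀ ℕ) : ∃ i j n, m = expo i j n :=
  ⟨m 0, m 1, m 2, by ext s; fin_cases s <;> rfl⟩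

theorem monomial_expo (i j n : ℕ) :
    MvPowerSeries.monomial (expo i j n) (1 : ℚ) = x ^ i * y ^ j * t ^ n := by
  rw [x, y, t, MvPowerSeries.X_pow_eq, MvPowerSeries.X_pow_eq, MvPowerSeries.X_pow_eq,
    MvPowerSeries.monomial_mul_monomial, MvPowerSeries.monomial_mul_monomial, one_mul, one_mul]
  congr 2
  ext s
  fin_cases s <;> simp [expo]

theorem coeff_expo_monomial_mul (i j n a b c : ℕ) (f : Ser) :
    MvPowerSeries.coeff (expo i j n) (x ^ a * y ^ b * t ^ c * f)
      = if a ≤ i ∧ b ≤ j ∧ c ≤ n then MvPowerSeries.coeff (expo (i - a) (j - b) (n - c)) f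
        else 0 := by
  rw [← monomial_expo, MvPowerSeries.coeff_monomial_mul, one_mul]
  have h₁ : expo a b c ≤ expo i j n ↔ a ≤ i ∧ b ≤ j ∧ c ≤ n := by
    simp [Finsupp.le_def, Fin.forall_fin_succ, expo]
  have h₂ : expo i j n - expo a b c = expo (i - a) (j - b) (n - c) := by
    ext s
    fin_cases s <;> simp [expo]
  simp only [h₁, h₂]

theorem rescale_x (r : Fin 3 → ℚ) : MvPowerSeries.rescale r x = r 0 • x := by
  rw [MvPowerSeries.rescale_eq_subst, x, MvPowerSeries.subst_X (MvPowerSeries.HasSubst.smul_X r)]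
  rfl

theorem rescale_y (r : Fin 3 → ℚ) : MvPowerSeries.rescale r y = r 1 • y := by
  rw [MvPowerSeries.rescale_eq_subst, y, MvPowerSeries.subst_X (MvPowerSeries.HasSubst.smul_X r)]
  rfl

theorem rescale_t (r : Fin 3 → ℚ) : MvPowerSeries.rescale r t = r 2 • t := by
  rw [MvPowerSeries.rescale_eq_subst, t, MvPowerSeries.subst_X (MvPowerSeries.HasSubst.smul_X r)]
  rfl

theorem coeff_expo_rescale (i j n : ℕ) (a b c : ℚ) (f : Ser) :
    MvPowerSeries.coeff (expo i j n) (MvPowerSeries.rescale ![a, b, c] f)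
      = a ^ i * b ^ j * c ^ n * MvPowerSeries.coeff (expo i j n) f := by
  rw [MvPowerSeries.coeff_rescale, Finsupp.prod_fintype _ _ (by simp), Fin.prod_univ_three]
  rfl

/-- Rescaling a variable by `0` evaluates it at `0`; in this form the map is an algebra homomorphism
with explicit coefficients. -/
theorem Qat_x_zero : Qat x 0 = MvPowerSeries.rescale ![1, 0, 1] Q := by
  rw [Qat, MvPowerSeries.rescale_eq_subst]
  congr 1
  ext1 s
  fin_cases s <;> simp [x, t]

theorem Qat_zero_zero : Qat 0 0 = MvPowerSeries.rescale ![0, 0, 1] Q := by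
  rw [Qat, MvPowerSeries.rescale_eq_subst]
  congr 1
  ext1 s
  fin_cases s <;> simp [t]

/-- The polynomial `1 + x ^ 2 y + x y ^ 2`. -/
def stepPoly : Ser := 1 + x ^ 2 * y + x * y ^ 2

/-- The kernel `x y - t (1 + x ^ 2 y + x y ^ 2)`. -/
def kernel : Ser := x * y - t * stepPoly

/-- `f(x, 0; t) + f(0, y; t) - f(0, 0; t)`. -/
def boundary (f : Ser) : Ser :=
  MvPowerSeries.rescale ![1, 0, 1] f + MvPowerSeries.rescale ![0, 1, 1] f
    - MvPowerSeries.rescale ![0, 0, 1] f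

theorem kernel_mul_Q : kernel * Q = x * y - t * boundary Q := by
  have h : ∀ f : Ser, kernel * f = x ^ 1 * y ^ 1 * t ^ 0 * f - x ^ 2 * y ^ 1 * t ^ 1 * f
      - x ^ 1 * y ^ 2 * t ^ 1 * f - x ^ 0 * y ^ 0 * t ^ 1 * f := by
    intro f
    simp only [kernel, stepPoly]
    ring
  have h' : x * y - t * boundary Q
      = x ^ 1 * y ^ 1 * t ^ 0 * 1 - x ^ 0 * y ^ 0 * t ^ 1 * boundary Q := by ring
  ext m
  obtain ⟨i, j, n, rfl⟩ := exists_expo m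
  rw [h, h']
  simp only [map_sub, map_add, coeff_expo_monomial_mul, boundary, coeff_expo_rescale, coeff_Q]
  have one : ∀ a b c, MvPowerSeries.coeff (expo a b c) (1 : Ser)
      = if a = 0 ∧ b = 0 ∧ c = 0 then 1 else 0 := by
    intro a b c
    rw [MvPowerSeries.coeff_one]
    congr 1
    simp [Finsupp.ext_iff, Fin.forall_fin_succ, expo]
  simp only [one]
  have e0 : ∀ a b c, expo a b c 0 = a := fun _ _ _ => rfl
  have e1 : ∀ a b c, expo a b c 1 = b := fun _ _ _ => rfl
  have e2 : ∀ a b c, expo a b c 2 = c := fun _ _ _ => rfl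
  simp only [e0, e1, e2]
  -- If `i = 0` or `j = 0`, only the `t` term of the kernel and the boundary contribute, with `0 ^ 0
  -- = 1` selecting the axis terms. Otherwise, apart from `xy` itself at `n = 0`, this is the
  -- last-step recurrence, shifted by one in each index.
  rcases i with _ | i
  · rcases n with _ | n <;> rcases j with _ | j <;> simp
  rcases j with _ | j
  · rcases n with _ | n <;> simp
  rcases n with _ | n
  · simp [endCount_zero, Prod.ext_iff]
  have hr := endCount_succ n (Int.natCast_nonneg i) (Int.natCast_nonneg j)
  have hi : endCount ((i : ℤ) - 1, (j : ℤ)) n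
      = if 2 ≤ i + 1 then endCount (((i + 1 - 2 : ℕ) : ℤ), (j : ℤ)) n else 0 := by
    split_ifs with hc
    · congr 2; omega
    · exact endCount_of_neg _ (by simp; omega)
  have hj : endCount ((i : ℤ), (j : ℤ) - 1) n
      = if 2 ≤ j + 1 then endCount ((i : ℤ), ((j + 1 - 2 : ℕ) : ℤ)) n else 0 := by
    split_ifs with hc
    · congr 2; omega
    · exact endCount_of_neg _ (by simp; omega)
  rw [hi, hj] at hr
  simp [hr]
  ring

/-! ### The series `T` and square roots with constant term 1 -/

open MvPowerSeries (constantCoeff rescale rescaleAlgHom rescaleAlgHom_apply)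

/-- No continuity is needed: `f - c` is a unit for every scalar `c` other than the constant term of
`f`, and homomorphisms preserve units. -/
theorem constantCoeff_algHom (φ : Ser →ₐ[ℚ] Ser) (f : Ser) :
    constantCoeff (φ f) = constantCoeff f := by
  by_contra hne
  have hu : IsUnit (f - algebraMap ℚ Ser (constantCoeff (φ f))) := by
    rw [MvPowerSeries.isUnit_iff_constantCoeff, isUnit_iff_ne_zero]
    simpa [MvPowerSeries.algebraMap_apply, sub_eq_zero] using Ne.symm hne
  have h := hu.map φ
  rw [MvPowerSeries.isUnit_iff_constantCoeff, isUnit_iff_ne_zero] at h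
  exact h (by rw [map_sub, AlgHom.commutes]; simp [MvPowerSeries.algebraMap_apply])

theorem algHom_inv (φ : Ser →ₐ[ℚ] Ser) {f : Ser} (hf : constantCoeff f ≠ 0) :
    φ f⁻¹ = (φ f)⁻¹ := by
  rw [MvPowerSeries.eq_inv_iff_mul_eq_one (by rwa [constantCoeff_algHom]), ← map_mul,
    MvPowerSeries.inv_mul_cancel f hf, map_one]

theorem constantCoeff_x : constantCoeff x = 0 := by simp [x]

theorem constantCoeff_y : constantCoeff y = 0 := by simp [y]

theorem constantCoeff_t : constantCoeff t = 0 := by simp [t]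

theorem hasSubst_t : PowerSeries.HasSubst t :=
  PowerSeries.HasSubst.of_constantCoeff_zero constantCoeff_t

theorem inT_eq {T : PowerSeries ℚ} (hT : T = PowerSeries.X * (2 + T ^ 3)) :
    inT T = t * (2 + inT T ^ 3) := by
  have h := congrArg (PowerSeries.substAlgHom hasSubst_t) hT
  simp only [map_mul, map_add, map_pow, map_ofNat, PowerSeries.substAlgHom_X] at h
  simpa only [PowerSeries.coe_substAlgHom, inT] using! h

/-- The cofactor of `a - b` has constant term 1, so it is nonzero. -/
theorem fixedPoint_unique {a b : Ser} (ha : a = t * (2 + a ^ 3)) (hb : b = t * (2 + b ^ 3)) :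
    a = b := by
  have h : (a - b) * (1 - t * (a ^ 2 + a * b + b ^ 2)) = 0 := by
    linear_combination ha - hb
  rcases mul_eq_zero.1 h with h | h
  · exact sub_eq_zero.1 h
  · simpa [constantCoeff_t] using congrArg constantCoeff h

theorem existsUnique_T : ∃! T : PowerSeries ℚ, T = PowerSeries.X * (2 + T ^ 3) := by
  refine existsUnique_of_exists_of_unique ?_ ?_
  · let c : PowerSeries ℚ := algebraMap ℚ (PowerSeries ℚ) (1 / 2)
    have hc : 2 * c = 1 := by
      simp only [c]
      rw [← map_ofNat (algebraMap ℚ (PowerSeries ℚ)) 2, ← map_mul]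
      norm_num
    -- Putting `T = X / z` turns the equation into `z³ - z²/2 + X³/2 = 0`. Modulo `X` it has the
    -- simple root `1/2`, where the derivative is `1/4`, so Hensel's lemma applies.
    let f : Polynomial (PowerSeries ℚ) :=
      Polynomial.X ^ 3 - Polynomial.C c * Polynomial.X ^ 2
        + Polynomial.C (c * PowerSeries.X ^ 3)
    have hf : f.Monic := by
      simp only [f]
      monicity!
    obtain ⟨z, hz, hz0⟩ := HenselianRing.is_henselian
      (I := Ideal.span {(PowerSeries.X : PowerSeries ℚ)}) f hf c
      (by
        rw [Ideal.mem_span_singleton]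
        refine ⟨c * PowerSeries.X ^ 2, ?_⟩
        simp only [f, Polynomial.eval_add, Polynomial.eval_sub, Polynomial.eval_mul,
          Polynomial.eval_pow, Polynomial.eval_X, Polynomial.eval_C]
        ring)
      (by
        refine IsUnit.map _ (IsUnit.of_mul_eq_one (4 : PowerSeries ℚ) ?_)
        simp only [f, Polynomial.derivative_add, Polynomial.derivative_sub,
          Polynomial.derivative_X_pow, Polynomial.derivative_C_mul, Polynomial.derivative_C,
          Polynomial.eval_add, Polynomial.eval_sub, Polynomial.eval_mul, Polynomial.eval_pow,
          Polynomial.eval_X, Polynomial.eval_C, Polynomial.eval_zero]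
        norm_num
        linear_combination (2 * c + 1) * hc)
    rw [Ideal.mem_span_singleton, PowerSeries.X_dvd_iff, map_sub, sub_eq_zero] at hz0
    have hzc : PowerSeries.constantCoeff z ≠ 0 := by
      rw [hz0]
      simp [c, PowerSeries.algebraMap_apply]
    have hr : z ^ 3 - c * z ^ 2 + c * PowerSeries.X ^ 3 = 0 := by
      simpa [f, Polynomial.IsRoot.def] using hz
    have hi : z * z⁻¹ = 1 := PowerSeries.mul_inv_cancel z hzc
    refine ⟨PowerSeries.X * z⁻¹, ?_⟩
    generalize z⁻¹ = w at hi
    linear_combination (-2 * PowerSeries.X * w ^ 3) * hr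
      + PowerSeries.X * w ^ 3 * (PowerSeries.X ^ 3 - z ^ 2) * hc
      + (2 * PowerSeries.X * (z ^ 2 * w ^ 2 + z * w + 1) - PowerSeries.X * w * (z * w + 1)) * hi
  · intro a b ha hb
    have h : (a - b) * (1 - PowerSeries.X * (a ^ 2 + a * b + b ^ 2)) = 0 := by
      linear_combination ha - hb
    rcases mul_eq_zero.1 h with h | h
    · exact sub_eq_zero.1 h
    · simpa using congrArg PowerSeries.constantCoeff h

theorem IsSqrt.unique {f V W : Ser} (hV : IsSqrt f V) (hW : IsSqrt f W) : V = W := by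
  rcases sq_eq_sq_iff_eq_or_eq_neg.1 (hV.1.trans hW.1.symm) with h | h
  · exact h
  · have := congrArg constantCoeff h
    rw [map_neg, hV.2, hW.2] at this
    norm_num at this

theorem exists_isSqrt {f : Ser} (hf : constantCoeff f = 1) : ∃ V, IsSqrt f V := by
  have hs : PowerSeries.HasSubst (f - 1) :=
    PowerSeries.HasSubst.of_constantCoeff_zero (by simp [hf])
  -- The series `(1 + X)^(1/2)`, to be evaluated at `X = f - 1`.
  let B : PowerSeries ℚ := PowerSeries.binomialSeries ℚ (1 / 2 : ℚ)
  have hB : B ^ 2 = 1 + PowerSeries.X := by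
    rw [sq, ← PowerSeries.binomialSeries_add]
    have := PowerSeries.binomialSeries_nat (R := ℚ) (A := ℚ) 1
    norm_num at this
    norm_num [this]
  let W := PowerSeries.substAlgHom hs B
  have hW : W ^ 2 = f := by
    simp only [W]
    rw [← map_pow, hB, map_add, map_one, PowerSeries.substAlgHom_X]
    ring
  have hc : constantCoeff W = 1 ∨ constantCoeff W = -1 := by
    exact sq_eq_one_iff.1 (by rw [← map_pow, hW, hf])
  rcases hc with h | h
  · exact ⟨W, hW, h⟩
  · exact ⟨-W, by rw [neg_sq, hW], by rw [map_neg, h, neg_neg]⟩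

/-! ### Primality of the kernel and uniqueness for the kernel equation -/

theorem t_dvd_iff (f : Ser) : t ∣ f ↔ rescale ![1, 1, 0] f = 0 := by
  constructor
  · rintro ⟨g, rfl⟩
    simp [rescale_t]
  · intro h
    rw [t, MvPowerSeries.X_dvd_iff]
    intro m hm
    obtain ⟨i, j, n, rfl⟩ := exists_expo m
    obtain rfl : n = 0 := hm
    have := congrArg (MvPowerSeries.coeff (expo i j 0)) h
    rw [coeff_expo_rescale] at this
    simpa using this

theorem X_ne_zero (s : Fin 3) : (MvPowerSeries.X s : Ser) ≠ 0 := fun h => by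
  simpa using congrArg (MvPowerSeries.coeff (Finsupp.single s 1)) h

theorem x_ne_zero : x ≠ 0 := X_ne_zero 0

theorem y_ne_zero : y ≠ 0 := X_ne_zero 1

theorem t_ne_zero : t ≠ 0 := X_ne_zero 2

theorem t_prime : Prime t := by
  refine ⟨t_ne_zero, ?_, ?_⟩
  · rw [MvPowerSeries.isUnit_iff_constantCoeff, constantCoeff_t]
    simp
  · intro a b
    simp only [t_dvd_iff, map_mul, mul_eq_zero]
    exact id

theorem constantCoeff_stepPoly : constantCoeff stepPoly = 1 := by
  simp [stepPoly, constantCoeff_x, constantCoeff_y]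

theorem stepPoly_mul_inv : stepPoly * stepPoly⁻¹ = 1 :=
  MvPowerSeries.mul_inv_cancel _ (by simp [constantCoeff_stepPoly])

theorem constantCoeff_kernel : constantCoeff kernel = 0 := by
  simp [kernel, constantCoeff_x, constantCoeff_t]

theorem hasSubst_vec {a b c : Ser} (ha : constantCoeff a = 0) (hb : constantCoeff b = 0)
    (hc : constantCoeff c = 0) : MvPowerSeries.HasSubst (![a, b, c] : Fin 3 → Ser) := by
  apply MvPowerSeries.hasSubst_of_constantCoeff_zero
  intro s
  fin_cases s
  exacts [ha, hb, hc]

/-- The substitution `t ↦ f` that fixes `x` and `y`. -/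
def substT (f : Ser) (hf : constantCoeff f = 0) : Ser →ₐ[ℚ] Ser :=
  MvPowerSeries.substAlgHom (hasSubst_vec constantCoeff_x constantCoeff_y hf)

theorem substT_x (f : Ser) (hf : constantCoeff f = 0) : substT f hf x = x :=
  MvPowerSeries.substAlgHom_X _ 0

theorem substT_y (f : Ser) (hf : constantCoeff f = 0) : substT f hf y = y :=
  MvPowerSeries.substAlgHom_X _ 1

theorem substT_t (f : Ser) (hf : constantCoeff f = 0) : substT f hf t = f :=
  MvPowerSeries.substAlgHom_X _ 2

theorem substT_stepPoly (f : Ser) (hf : constantCoeff f = 0) :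
    substT f hf stepPoly = stepPoly := by
  simp [stepPoly, substT_x, substT_y]

theorem substT_comp_substT {f g : Ser} (hf : constantCoeff f = 0) (hg : constantCoeff g = 0)
    (h : substT g hg f = t) : (substT g hg).comp (substT f hf) = AlgHom.id ℚ Ser := by
  ext1 p
  have h₁ : substT g hg (substT f hf p)
      = MvPowerSeries.subst (fun s => MvPowerSeries.subst ![x, y, g] (![x, y, f] s)) p := by
    rw [← MvPowerSeries.subst_comp_subst_apply
      (hasSubst_vec constantCoeff_x constantCoeff_y hf)
      (hasSubst_vec constantCoeff_x constantCoeff_y hg)]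
    simp [substT]
  have h₂ : (fun s => MvPowerSeries.subst ![x, y, g] (![x, y, f] s))
      = (MvPowerSeries.X : Fin 3 → Ser) := by
    ext1 s
    have e : ∀ q, MvPowerSeries.subst ![x, y, g] q = substT g hg q := fun q => by
      rw [substT, MvPowerSeries.coe_substAlgHom]
    rw [e]
    fin_cases s
    exacts [substT_x g hg, substT_y g hg, h]
  rw [AlgHom.comp_apply, h₁, h₂, MvPowerSeries.subst_self]
  rfl

/-- The substitutions `t ↦ kernel` and `t ↦ (xy - t) / stepPoly` are mutually inverse, so primality
carries over from `t`. -/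
theorem kernel_prime : Prime kernel := by
  have hg : constantCoeff ((x * y - t) * stepPoly⁻¹) = 0 := by
    simp [constantCoeff_x, constantCoeff_t]
  have h₁ : substT _ hg kernel = t := by
    simp only [kernel, map_sub, map_mul, substT_x, substT_y, substT_t, substT_stepPoly]
    linear_combination (t - x * y) * stepPoly_mul_inv
  have h₂ : substT kernel constantCoeff_kernel ((x * y - t) * stepPoly⁻¹) = t := by
    simp only [map_sub, map_mul, substT_x, substT_y, substT_t]
    rw [algHom_inv _ (by simp [constantCoeff_stepPoly]), substT_stepPoly, kernel]
    linear_combination t * stepPoly_mul_inv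
  let e : Ser ≃ₐ[ℚ] Ser := AlgEquiv.ofAlgHom _ _
    (substT_comp_substT hg constantCoeff_kernel h₂)
    (substT_comp_substT constantCoeff_kernel hg h₁)
  have he : e t = kernel := substT_t _ constantCoeff_kernel
  rw [← he]
  exact (MulEquiv.prime_iff e).2 t_prime

/-- The equation `kernel * f = c - t * boundary f` has at most one solution. -/
theorem boundary_unique {c f g : Ser} (hf : kernel * f = c - t * boundary f)
    (hg : kernel * g = c - t * boundary g) : f = g := by
  have hx : ¬ t ∣ x := by
    rw [t_dvd_iff, rescale_x]
    simp [x_ne_zero]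
  have hy : ¬ t ∣ y := by
    rw [t_dvd_iff, rescale_y]
    simp [y_ne_zero]
  -- The difference is divisible by every power of `t`: the homogeneous equation gives `t ∣ xyd`,
  -- hence `t ∣ d`, and `d / t` satisfies it again.
  have key : ∀ n : ℕ, ∃ d, f - g = t ^ n * d ∧ kernel * d = - (t * boundary d) := by
    intro n
    induction n with
    | zero =>
      refine ⟨f - g, by simp, ?_⟩
      simp only [boundary, map_sub] at hf hg ⊢
      linear_combination hf - hg
    | succ n ih =>
      obtain ⟨d, hd, hk⟩ := ih
      have hdvd : t ∣ x * y * d := ⟨stepPoly * d - boundary d, by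
        simp only [kernel] at hk
        linear_combination hk⟩
      obtain ⟨e, rfl⟩ := ((t_prime.dvd_or_dvd hdvd).resolve_left fun h =>
        (t_prime.dvd_or_dvd h).elim hx hy)
      refine ⟨e, by rw [hd]; ring, mul_left_cancel₀ t_ne_zero ?_⟩
      have hb : boundary (t * e) = t * boundary e := by
        simp only [boundary, map_mul, rescale_t]
        simp
        ring
      rw [hb] at hk
      linear_combination hk
  rw [← sub_eq_zero]
  ext m
  obtain ⟨d, hd, -⟩ := key (m 2 + 1)
  exact MvPowerSeries.X_pow_dvd_iff.1 (Dvd.intro d hd.symm) m (Nat.lt_succ_self _)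

/-! ### The closed form on the axes -/

theorem four_mul_quarter_smul (a : Ser) : 4 * ((1 / 4 : ℚ) • a) = a := by
  rw [Algebra.smul_def, ← mul_assoc, ← map_ofNat (algebraMap ℚ Ser) 4, ← map_mul]
  norm_num

theorem four_mul_U (T : PowerSeries ℚ) (u : Ser) :
    4 * U T u = 4 - 4 * u * inT T - u * inT T ^ 4 + u ^ 2 * inT T ^ 2 := by
  rw [U]
  linear_combination (-u * inT T) * four_mul_quarter_smul (inT T ^ 3)
    + four_mul_quarter_smul (u ^ 2 * inT T ^ 2)

theorem constantCoeff_U (T : PowerSeries ℚ) {u : Ser} (hu : constantCoeff u = 0) :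
    constantCoeff (U T u) = 1 := by
  simp [U, hu]

theorem constantCoeff_inT {T : PowerSeries ℚ} (hT : T = PowerSeries.X * (2 + T ^ 3)) :
    constantCoeff (inT T) = 0 := by
  rw [inT_eq hT]
  simp [constantCoeff_t]

/-- The image of `T` satisfies the same fixed-point equation, which has a single solution. -/
theorem algHom_inT {T : PowerSeries ℚ} (hT : T = PowerSeries.X * (2 + T ^ 3))
    {φ : Ser →ₐ[ℚ] Ser} (hφ : φ t = t) : φ (inT T) = inT T := by
  refine fixedPoint_unique ?_ (inT_eq hT)
  conv_lhs => rw [inT_eq hT]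
  simp only [map_mul, map_add, map_pow, map_ofNat, hφ]

theorem algHom_U {T : PowerSeries ℚ} (hT : T = PowerSeries.X * (2 + T ^ 3))
    {φ : Ser →ₐ[ℚ] Ser} (hφ : φ t = t) (u : Ser) : φ (U T u) = U T (φ u) := by
  simp only [U, map_add, map_sub, map_mul, map_smul, map_pow, map_one, algHom_inT hT hφ]

theorem IsSqrt.algHom {f V : Ser} (h : IsSqrt f V) (φ : Ser →ₐ[ℚ] Ser) : IsSqrt (φ f) (φ V) :=
  ⟨by rw [← map_pow, h.1], by rw [constantCoeff_algHom, h.2]⟩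

/-- The square root of `U(u)` with constant term `1`, for `u` without constant term. -/
def sqrtU (T : PowerSeries ℚ) (u : Ser) : Ser := Classical.epsilon (IsSqrt (U T u))

theorem isSqrt_sqrtU (T : PowerSeries ℚ) {u : Ser} (hu : constantCoeff u = 0) :
    IsSqrt (U T u) (sqrtU T u) :=
  Classical.epsilon_spec (exists_isSqrt (constantCoeff_U T hu))

theorem algHom_sqrtU {T : PowerSeries ℚ} (hT : T = PowerSeries.X * (2 + T ^ 3))
    {φ : Ser →ₐ[ℚ] Ser} (hφ : φ t = t) {u : Ser} (hu : constantCoeff u = 0) :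
    φ (sqrtU T u) = sqrtU T (φ u) := by
  have h := (isSqrt_sqrtU T hu).algHom φ
  rw [algHom_U hT hφ] at h
  exact h.unique (isSqrt_sqrtU T (by rwa [constantCoeff_algHom]))

theorem sqrtU_zero (T : PowerSeries ℚ) : sqrtU T 0 = 1 := by
  have h := isSqrt_sqrtU T (u := 0) (map_zero _)
  have hU : U T 0 = 1 := by simp [U]
  rw [hU] at h
  exact h.unique ⟨one_pow 2, map_one _⟩

/-- The denominator `2 √U(u) + 2 - u T`, a unit. -/
def axisDenom (T : PowerSeries ℚ) (u : Ser) : Ser := 2 * sqrtU T u + 2 - u * inT T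

theorem constantCoeff_axisDenom (T : PowerSeries ℚ) {u : Ser} (hu : constantCoeff u = 0) :
    constantCoeff (axisDenom T u) = 4 := by
  simp only [axisDenom, map_sub, map_add, map_mul, hu, (isSqrt_sqrtU T hu).2, map_ofNat]
  norm_num

theorem axisDenom_mul_inv (T : PowerSeries ℚ) {u : Ser} (hu : constantCoeff u = 0) :
    axisDenom T u * (axisDenom T u)⁻¹ = 1 :=
  MvPowerSeries.mul_inv_cancel _ (by rw [constantCoeff_axisDenom T hu]; norm_num)

/-- The series `A(u)` for which `4 Q(u, 0; t) = (2 + T ^ 3) (A(u) + A(0))`. -/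
def axisSeries (T : PowerSeries ℚ) (u : Ser) : Ser :=
  1 + u * inT T
    - (inT T + u * inT T ^ 2 - 2 * u ^ 2) * inT T ^ 2 * (axisDenom T u)⁻¹

theorem axisSeries_spec (T : PowerSeries ℚ) {u : Ser} (hu : constantCoeff u = 0) :
    u * inT T ^ 2 * axisSeries T u = 2 * ((inT T + u * inT T ^ 2 - 2 * u ^ 2) * sqrtU T u
      + (2 + inT T ^ 3) * u ^ 2 - inT T * u ^ 3 - inT T) := by
  have h₁ := axisDenom_mul_inv T hu
  have h₂ : 4 * sqrtU T u ^ 2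
      = 4 - 4 * u * inT T - u * inT T ^ 4 + u ^ 2 * inT T ^ 2 := by
    rw [(isSqrt_sqrtU T hu).1, four_mul_U]
  -- Rationalization: `4U(u) - (2 - uT)² = -uT⁴`. The factor `u` is what makes `axisSeries` a power
  -- series, defined also at `u = 0`.
  have h₃ : 2 * sqrtU T u - 2 + u * inT T = - (u * inT T ^ 4 * (axisDenom T u)⁻¹) := by
    generalize hE : (axisDenom T u)⁻¹ = E at h₁ ⊢
    rw [axisDenom] at h₁
    linear_combination E * h₂ - (2 * sqrtU T u - 2 + u * inT T) * h₁
  rw [axisSeries]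
  linear_combination (-(inT T + u * inT T ^ 2 - 2 * u ^ 2)) * h₃

theorem algHom_axisSeries {T : PowerSeries ℚ} (hT : T = PowerSeries.X * (2 + T ^ 3))
    {φ : Ser →ₐ[ℚ] Ser} (hφ : φ t = t) {u : Ser} (hu : constantCoeff u = 0) :
    φ (axisSeries T u) = axisSeries T (φ u) := by
  have hd : φ (axisDenom T u) = axisDenom T (φ u) := by
    simp only [axisDenom, map_add, map_sub, map_mul, map_ofNat, algHom_inT hT hφ,
      algHom_sqrtU hT hφ hu]
  simp only [axisSeries, map_add, map_sub, map_mul, map_pow, map_one, map_ofNat,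
    algHom_inT hT hφ]
  rw [algHom_inv φ (by rw [constantCoeff_axisDenom T hu]; norm_num), hd]

theorem axisSeries_zero (T : PowerSeries ℚ) : 4 * axisSeries T 0 = 4 - inT T ^ 3 := by
  have h := axisDenom_mul_inv T (u := 0) (map_zero _)
  rw [axisSeries]
  generalize (axisDenom T 0)⁻¹ = E at h ⊢
  rw [axisDenom, sqrtU_zero] at h
  linear_combination (-inT T ^ 3) * h

/-! ### Divisibility by the kernel -/

theorem rescale_kernel (r : Fin 3 → ℚ) (h : r 0 * r 1 = 0) (ht : r 2 = 0) :
    rescale r kernel = 0 := by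
  simp [kernel, rescale_x, rescale_y, rescale_t, ht, smul_smul, h, mul_comm]

theorem not_kernel_dvd_x : ¬ kernel ∣ x := by
  rintro ⟨g, hg⟩
  have h := congrArg (rescale ![1, 0, 0]) hg
  rw [map_mul, rescale_kernel _ (by simp) (by simp), rescale_x, zero_mul] at h
  exact x_ne_zero (by simpa using h)

theorem not_kernel_dvd_y : ¬ kernel ∣ y := by
  rintro ⟨g, hg⟩
  have h := congrArg (rescale ![0, 1, 0]) hg
  rw [map_mul, rescale_kernel _ (by simp) (by simp), rescale_y, zero_mul] at h
  exact y_ne_zero (by simpa using h)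

theorem not_kernel_dvd_t : ¬ kernel ∣ t := by
  intro h
  have h' : kernel ∣ x * y := by
    have : x * y = kernel + t * stepPoly := by rw [kernel]; ring
    rw [this]
    exact dvd_add dvd_rfl (h.mul_right _)
  exact (kernel_prime.dvd_or_dvd h').elim not_kernel_dvd_x not_kernel_dvd_y

theorem not_kernel_dvd_of_constantCoeff_ne_zero {f : Ser} (hf : constantCoeff f ≠ 0) :
    ¬ kernel ∣ f := by
  rintro ⟨g, rfl⟩
  simp [constantCoeff_kernel] at hf

theorem not_kernel_dvd_inT {T : PowerSeries ℚ} (hT : T = PowerSeries.X * (2 + T ^ 3)) :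
    ¬ kernel ∣ inT T := by
  rw [inT_eq hT]
  intro h
  refine (kernel_prime.dvd_or_dvd h).elim not_kernel_dvd_t
    (not_kernel_dvd_of_constantCoeff_ne_zero ?_)
  simp [constantCoeff_inT hT, map_ofNat constantCoeff 2]

theorem not_kernel_dvd_sub {T : PowerSeries ℚ} (hT : T = PowerSeries.X * (2 + T ^ 3)) :
    ¬ kernel ∣ y * (inT T + x * inT T ^ 2 - 2 * x ^ 2) * sqrtU T x
      - x * (inT T + y * inT T ^ 2 - 2 * y ^ 2) * sqrtU T y := by
  intro h
  have hτ := inT_eq hT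
  -- The difference itself vanishes at `y = t = 0`, so this specialization does not decide. Modulo
  -- the kernel it equals `t * b`, and `b` specializes to `-4x` while the kernel specializes to `0`.
  set b : Ser := (y * (2 + inT T ^ 3) + stepPoly * inT T ^ 2 - 2 * x * stepPoly) * sqrtU T x
    - (x * (2 + inT T ^ 3) + stepPoly * inT T ^ 2 - 2 * y * stepPoly) * sqrtU T y with hb
  have htb : kernel ∣ t * b := by
    have e : t * b = (y * (inT T + x * inT T ^ 2 - 2 * x ^ 2) * sqrtU T x
        - x * (inT T + y * inT T ^ 2 - 2 * y ^ 2) * sqrtU T y)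
        - kernel * ((inT T ^ 2 - 2 * x) * sqrtU T x - (inT T ^ 2 - 2 * y) * sqrtU T y) := by
      rw [hb, kernel]
      linear_combination (x * sqrtU T y - y * sqrtU T x) * hτ
    rw [e]
    exact dvd_sub h (dvd_mul_right _ _)
  obtain ⟨g, hg⟩ := (kernel_prime.dvd_or_dvd htb).resolve_left not_kernel_dvd_t
  let ψ : Ser →ₐ[ℚ] Ser := rescaleAlgHom ![1, 0, 0]
  have hψ : ∀ f, ψ f = rescale ![1, 0, 0] f := rescaleAlgHom_apply _
  have hx : ψ x = x := by rw [hψ, rescale_x]; simp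
  have hy : ψ y = 0 := by rw [hψ, rescale_y]; simp
  have ht : ψ t = 0 := by rw [hψ, rescale_t]; simp
  have hT0 : ψ (inT T) = 0 := by rw [hτ, map_mul, ht, zero_mul]
  have hs : ∀ {u : Ser}, constantCoeff u = 0 → ψ (sqrtU T u) = 1 := by
    intro u hu
    have h := (isSqrt_sqrtU T hu).algHom ψ
    have hU : ψ (U T u) = 1 := by simp [U, hT0]
    rw [hU] at h
    exact h.unique ⟨one_pow 2, map_one _⟩
  have h0 : ψ b = 0 := by
    rw [hg, map_mul, hψ kernel, rescale_kernel _ (by simp) (by simp), zero_mul]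
  have h1 : ψ b = -4 * x := by
    simp only [hb, stepPoly, map_sub, map_mul, map_add, map_pow, map_one, map_ofNat, hx, hy, hT0,
      hs constantCoeff_x, hs constantCoeff_y]
    ring
  have : (4 : Ser) * x = 0 := by linear_combination h1 - h0
  rcases mul_eq_zero.1 this with h | h
  · simpa [map_ofNat constantCoeff 4] using congrArg constantCoeff h
  · exact x_ne_zero h

theorem kernel_dvd {T : PowerSeries ℚ} (hT : T = PowerSeries.X * (2 + T ^ 3)) :
    kernel ∣ 4 * (x * y) - inT T * (axisSeries T x + axisSeries T y) := by
  have hτ := inT_eq hT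
  have hX : 4 * sqrtU T x ^ 2
      = 4 - 4 * x * inT T - x * inT T ^ 4 + x ^ 2 * inT T ^ 2 := by
    rw [(isSqrt_sqrtU T constantCoeff_x).1, four_mul_U]
  have hY : 4 * sqrtU T y ^ 2
      = 4 - 4 * y * inT T - y * inT T ^ 4 + y ^ 2 * inT T ^ 2 := by
    rw [(isSqrt_sqrtU T constantCoeff_y).1, four_mul_U]
  have hA := axisSeries_spec T constantCoeff_x
  have hB := axisSeries_spec T constantCoeff_y
  have hd := not_kernel_dvd_sub hT
  have hnτ := not_kernel_dvd_inT hT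
  have hK : kernel * (2 + inT T ^ 3)
      = x * y * (2 + inT T ^ 3) - inT T * (1 + x ^ 2 * y + x * y ^ 2) := by
    rw [kernel, stepPoly]
    linear_combination (1 + x ^ 2 * y + x * y ^ 2) * hτ
  generalize sqrtU T x = V at *
  generalize sqrtU T y = W at *
  generalize axisSeries T x = A at *
  generalize axisSeries T y = B at *
  generalize inT T = τ at *
  -- A difference of squares: `hX` and `hY` remove the radicals, and the remaining polynomial in
  -- `x`, `y`, `τ` is a multiple of `kernel * (2 + τ ^ 3)`.
  have hprod : kernel ∣ 4 * ((y * (τ + x * τ ^ 2 - 2 * x ^ 2) * V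
      + x * (τ + y * τ ^ 2 - 2 * y ^ 2) * W) * (y * (τ + x * τ ^ 2 - 2 * x ^ 2) * V
      - x * (τ + y * τ ^ 2 - 2 * y ^ 2) * W)) := by
    refine ⟨(2 + τ ^ 3) * (-4 * x ^ 4 * y * τ + 4 * x ^ 3 * y ^ 2 * τ + 4 * x ^ 3 * y * τ ^ 3
      + 8 * x ^ 3 * y - 4 * x ^ 2 * y ^ 3 * τ - x ^ 2 * y * τ ^ 5 + 4 * x ^ 2 * y * τ ^ 2
      + 4 * x ^ 2 * τ + 4 * x * y ^ 4 * τ - 4 * x * y ^ 3 * τ ^ 3 - 8 * x * y ^ 3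
      + x * y ^ 2 * τ ^ 5 - 4 * x * y ^ 2 * τ ^ 2 - 4 * y ^ 2 * τ), ?_⟩
    rw [← mul_assoc kernel, hK]
    linear_combination (y * (τ + x * τ ^ 2 - 2 * x ^ 2)) ^ 2 * hX
      - (x * (τ + y * τ ^ 2 - 2 * y ^ 2)) ^ 2 * hY
  have h4 : ¬ kernel ∣ 4 := not_kernel_dvd_of_constantCoeff_ne_zero
    (by simp [map_ofNat constantCoeff 4])
  obtain ⟨g, hg⟩ := (kernel_prime.dvd_or_dvd
    ((kernel_prime.dvd_or_dvd hprod).resolve_left h4)).resolve_right hd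
  -- By the defining identities of `A` and `B`, the radical part is `-2` times the sum just shown
  -- divisible, and the rest is `-2(x + y)(2 + τ³) * kernel`.
  have hfin : kernel ∣ x * (y * (τ * (4 * (x * y) - τ * (A + B)))) := by
    refine ⟨-2 * (2 + τ ^ 3) * (x + y) - 2 * g, ?_⟩
    linear_combination (-y) * hA - x * hB - 2 * hg + 2 * (x + y) * hK
  have h₁ := (kernel_prime.dvd_or_dvd hfin).resolve_left not_kernel_dvd_x
  have h₂ := (kernel_prime.dvd_or_dvd h₁).resolve_left not_kernel_dvd_y
  exact (kernel_prime.dvd_or_dvd h₂).resolve_left hnτ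

/-! ### Identification of `Q` -/

theorem kernel_mul_four_mul_Q_and_axes {T : PowerSeries ℚ} (hT : T = PowerSeries.X * (2 + T ^ 3)) :
    4 * (x * y) - inT T * (axisSeries T x + axisSeries T y) = kernel * (4 * Q) ∧
    4 * Qat x 0 = (2 + inT T ^ 3) * (axisSeries T x + axisSeries T 0) ∧
    4 * Qat 0 0 = (2 + inT T ^ 3) * (2 * axisSeries T 0) := by
  obtain ⟨G, hG⟩ := kernel_dvd hT
  have hτ := inT_eq hT
  -- As `ab = 0`, the image of `xy` is zero and the kernel becomes `-t`; cancelling `t` through `T =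
  -- t(2 + T³)` gives `G` on the axes.
  have key : ∀ a b : ℚ, a * b = 0 → rescale ![a, b, 1] G
      = (2 + inT T ^ 3) * (axisSeries T (a • x) + axisSeries T (b • y)) := by
    intro a b hab
    let φ : Ser →ₐ[ℚ] Ser := rescaleAlgHom ![a, b, 1]
    have hφ : ∀ f, φ f = rescale ![a, b, 1] f := rescaleAlgHom_apply _
    have hx : φ x = a • x := by rw [hφ, rescale_x]; rfl
    have hy : φ y = b • y := by rw [hφ, rescale_y]; rfl
    have ht : φ t = t := by rw [hφ, rescale_t]; simp
    have hxy : φ x * φ y = 0 := by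
      rw [hx, hy, smul_mul_smul_comm, hab, zero_smul]
    have h := congrArg φ hG
    simp only [kernel, stepPoly, map_sub, map_add, map_mul, map_pow, map_one, map_ofNat, ht,
      algHom_inT hT ht, algHom_axisSeries hT ht constantCoeff_x,
      algHom_axisSeries hT ht constantCoeff_y] at h
    rw [← hφ, ← hx, ← hy]
    refine mul_left_cancel₀ t_ne_zero ?_
    linear_combination h - (4 - φ G + t * φ G * (φ x + φ y)) * hxy
      + (axisSeries T (φ x) + axisSeries T (φ y)) * hτ
  have k₁ := key 1 0 (by simp)
  have k₂ := key 0 1 (by simp)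
  have k₃ := key 0 0 (by simp)
  simp only [one_smul, zero_smul] at k₁ k₂ k₃
  have hQ : 4 * Q = G := by
    refine boundary_unique (c := 4 * (x * y)) ?_ ?_
    · have hb : boundary (4 * Q) = 4 * boundary Q := by
        simp only [boundary, map_mul, map_ofNat]
        ring
      rw [hb]
      linear_combination 4 * kernel_mul_Q
    · rw [← hG, boundary, k₁, k₂, k₃]
      linear_combination (-(axisSeries T x + axisSeries T y)) * hτ
  refine ⟨by rw [hG, hQ], ?_, ?_⟩
  · rw [Qat_x_zero, ← k₁, ← hQ, map_mul, map_ofNat]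
  · rw [Qat_zero_zero, two_mul, ← k₃, ← hQ, map_mul, map_ofNat]

/-- Substituting `x ↦ y`, `y ↦ 0` in the identity for `x` suffices; the symmetry of `Q` is not
needed. -/
theorem four_mul_Qat_y_zero {T : PowerSeries ℚ} (hT : T = PowerSeries.X * (2 + T ^ 3)) :
    4 * Qat y 0 = (2 + inT T ^ 3) * (axisSeries T y + axisSeries T 0) := by
  have hs := hasSubst_Qat y 0 constantCoeff_y (map_zero _)
  let φ : Ser →ₐ[ℚ] Ser := MvPowerSeries.substAlgHom hs
  have hx : φ x = y := MvPowerSeries.substAlgHom_X hs 0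
  have ht : φ t = t := MvPowerSeries.substAlgHom_X hs 2
  have hq : φ (Qat x 0) = Qat y 0 := by
    simp only [φ, MvPowerSeries.coe_substAlgHom, Qat]
    rw [MvPowerSeries.subst_comp_subst_apply
      (hasSubst_Qat x 0 constantCoeff_x (map_zero _)) hs]
    congr 1
    ext1 s
    rw [← MvPowerSeries.coe_substAlgHom hs]
    fin_cases s
    exacts [hx, map_zero φ, ht]
  have h := congrArg φ (kernel_mul_four_mul_Q_and_axes hT).2.1
  simp only [map_mul, map_add, map_pow, map_ofNat, hq, algHom_inT hT ht,
    algHom_axisSeries hT ht constantCoeff_x, algHom_axisSeries hT ht (map_zero _), hx,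
    map_zero φ] at h
  exact h

theorem kernel_mul_Q_eq : kernel * Q = x * y - S x - S y := by
  obtain ⟨T, hT, -⟩ := existsUnique_T
  obtain ⟨h, hx, h0⟩ := kernel_mul_four_mul_Q_and_axes hT
  have hy := four_mul_Qat_y_zero hT
  have h2 : 2 * ((1 / 2 : ℚ) • Qat 0 0) = Qat 0 0 := by
    rw [Algebra.smul_def, ← mul_assoc, ← map_ofNat (algebraMap ℚ Ser) 2, ← map_mul]
    norm_num
  have h4 : (4 : Ser) ≠ 0 := fun h => by
    simpa [map_ofNat constantCoeff 4] using congrArg constantCoeff h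
  refine mul_left_cancel₀ h4 ?_
  rw [S, S]
  linear_combination (-1 : Ser) * h + t * hx + t * hy - 4 * t * h2 - t * h0
    - (axisSeries T x + axisSeries T y) * inT_eq hT

/-! ### Algebraicity -/

theorem isAlgebraic_Q : IsAlgebraic (MvPolynomial (Fin 3) ℚ) Q := by
  obtain ⟨T, hT, -⟩ := existsUnique_T
  have halg : ∀ s : Fin 3, IsAlgebraic (MvPolynomial (Fin 3) ℚ) (MvPowerSeries.X s : Ser) := by
    intro s
    have : algebraMap (MvPolynomial (Fin 3) ℚ) Ser (MvPolynomial.X s) = MvPowerSeries.X s := by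
      rw [MvPowerSeries.algebraMap_apply']
      simp
    rw [← this]
    exact isAlgebraic_algebraMap _
  have hx : IsAlgebraic (MvPolynomial (Fin 3) ℚ) x := halg 0
  have hy : IsAlgebraic (MvPolynomial (Fin 3) ℚ) y := halg 1
  have ht : IsAlgebraic (MvPolynomial (Fin 3) ℚ) t := halg 2
  have hn : ∀ n : ℕ, IsAlgebraic (MvPolynomial (Fin 3) ℚ) (n : Ser) := isAlgebraic_natCast
  have h1 : IsAlgebraic (MvPolynomial (Fin 3) ℚ) (1 : Ser) := isAlgebraic_one
  have h2 : IsAlgebraic (MvPolynomial (Fin 3) ℚ) (2 : Ser) := by simpa using hn 2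
  have h4 : IsAlgebraic (MvPolynomial (Fin 3) ℚ) (4 : Ser) := by simpa using hn 4
  have hτ : IsAlgebraic (MvPolynomial (Fin 3) ℚ) (inT T) := by
    let p : Polynomial (MvPolynomial (Fin 3) ℚ) :=
      Polynomial.C (MvPolynomial.X 2) * (2 + Polynomial.X ^ 3) - Polynomial.X
    refine ⟨p, ?_, ?_⟩
    · intro h
      have := congrArg (fun q => Polynomial.coeff q 1) h
      simp [p, Polynomial.coeff_X_pow, Polynomial.coeff_ofNat_succ] at this
    · have : algebraMap (MvPolynomial (Fin 3) ℚ) Ser (MvPolynomial.X 2) = t := by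
        rw [MvPowerSeries.algebraMap_apply']
        simp [t]
      simp only [p, map_sub, map_mul, map_add, map_pow, map_ofNat, Polynomial.aeval_X,
        Polynomial.aeval_C, this]
      exact sub_eq_zero.2 (inT_eq hT).symm
  have hne : ∀ {f : Ser}, constantCoeff f ≠ 0 → f ∈ nonZeroDivisors Ser := fun h =>
    mem_nonZeroDivisors_of_ne_zero fun h' => h (by rw [h', map_zero])
  have hA : ∀ {u : Ser}, constantCoeff u = 0 → IsAlgebraic (MvPolynomial (Fin 3) ℚ) u →
      IsAlgebraic (MvPolynomial (Fin 3) ℚ) (axisSeries T u) := by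
    intro u hu hua
    have hV : IsAlgebraic (MvPolynomial (Fin 3) ℚ) (2 * sqrtU T u) := by
      refine IsAlgebraic.of_pow two_pos ?_
      have : (2 * sqrtU T u) ^ 2
          = 4 - 4 * u * inT T - u * inT T ^ 4 + u ^ 2 * inT T ^ 2 := by
        rw [← four_mul_U, ← (isSqrt_sqrtU T hu).1]
        ring
      rw [this]
      exact ((h4.sub ((h4.mul hua).mul hτ)).sub (hua.mul (hτ.pow 4))).add
        ((hua.pow 2).mul (hτ.pow 2))
    have hd : IsAlgebraic (MvPolynomial (Fin 3) ℚ) (axisDenom T u) :=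
      (hV.add h2).sub (hua.mul hτ)
    have hi : IsAlgebraic (MvPolynomial (Fin 3) ℚ) (axisDenom T u)⁻¹ := by
      -- An element whose product with a nonzero algebraic element is algebraic is itself algebraic;
      -- this replaces division, here and for the kernel.
      refine hd.of_mul (hne (by rw [constantCoeff_axisDenom T hu]; norm_num)) ?_
      rw [axisDenom_mul_inv T hu]
      exact h1
    exact (h1.add (hua.mul hτ)).sub
      ((((hτ.add (hua.mul (hτ.pow 2))).sub (h2.mul (hua.pow 2))).mul (hτ.pow 2)).mul hi)
  have hK : IsAlgebraic (MvPolynomial (Fin 3) ℚ) kernel :=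
    (hx.mul hy).sub (ht.mul ((h1.add ((hx.pow 2).mul hy)).add (hx.mul (hy.pow 2))))
  have h4Q : IsAlgebraic (MvPolynomial (Fin 3) ℚ) (4 * Q) := by
    refine hK.of_mul (mem_nonZeroDivisors_of_ne_zero kernel_prime.ne_zero) ?_
    rw [← (kernel_mul_four_mul_Q_and_axes hT).1]
    exact (h4.mul (hx.mul hy)).sub
      (hτ.mul ((hA constantCoeff_x hx).add (hA constantCoeff_y hy)))
  exact h4.of_mul (hne (by simp [map_ofNat constantCoeff 4])) h4Q

/-! ### Formulas in the fraction field -/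

theorem ι_injective : Function.Injective ι := IsFractionRing.injective Ser SerFrac

theorem ι_ne_zero {f : Ser} (hf : f ≠ 0) : ι f ≠ 0 := (map_ne_zero_iff ι ι_injective).2 hf

theorem inT_ne_zero {T : PowerSeries ℚ} (hT : T = PowerSeries.X * (2 + T ^ 3)) : inT T ≠ 0 :=
  fun h => not_kernel_dvd_inT hT (by rw [h]; exact dvd_zero _)

theorem ι_Qat_zero_zero {T : PowerSeries ℚ} (hT : T = PowerSeries.X * (2 + T ^ 3)) :
    ι (Qat 0 0) = (4 * ι (inT T) - ι (inT T) ^ 4) / (8 * ι t) := by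
  have : CharZero SerFrac := algebraRat.charZero _
  rw [eq_div_iff (mul_ne_zero (by norm_num) (ι_ne_zero t_ne_zero))]
  have h : Qat 0 0 * (8 * t) = 4 * inT T - inT T ^ 4 := by
    linear_combination 2 * t * (kernel_mul_four_mul_Q_and_axes hT).2.2 + inT T * axisSeries_zero T
      - 4 * axisSeries T 0 * inT_eq hT
  simpa only [map_mul, map_sub, map_pow, map_ofNat] using congrArg ι h

theorem two_mul_ι_Qat {T : PowerSeries ℚ} (hT : T = PowerSeries.X * (2 + T ^ 3)) {u : Ser}
    (hu : constantCoeff u = 0) (hu0 : u ≠ 0)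
    (h : 4 * Qat u 0 = (2 + inT T ^ 3) * (axisSeries T u + axisSeries T 0)) :
    2 * ι (Qat u 0)
      = axisExpr (ι u) (ι t) (ι (inT T)) (ι (sqrtU T u)) (ι (Qat 0 0)) := by
  have : CharZero SerFrac := algebraRat.charZero _
  have h₁ := congrArg ι h
  have h₂ := congrArg ι (kernel_mul_four_mul_Q_and_axes hT).2.2
  have h₃ := congrArg ι (axisSeries_spec T hu)
  have h₄ := congrArg ι (inT_eq hT)
  simp only [map_mul, map_sub, map_add, map_pow, map_ofNat] at h₁ h₂ h₃ h₄
  have hu' := ι_ne_zero hu0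
  have ht' := ι_ne_zero t_ne_zero
  have hτ' := ι_ne_zero (inT_ne_zero hT)
  generalize ι (Qat u 0) = f at *
  generalize ι (Qat 0 0) = q at *
  generalize ι (axisSeries T u) = A at *
  generalize ι (axisSeries T 0) = A₀ at *
  generalize ι (sqrtU T u) = V at *
  generalize ι (inT T) = τ at *
  generalize ι u = v at *
  generalize ι t = z at *
  -- Clearing the denominators of `axisExpr` produces the coefficient of `V` that occurs in
  -- `axisSeries_spec`.
  have e : v * τ * z ^ 2 * axisExpr v z τ V q = v * τ * z ^ 2 * q
      + z * (τ + v * τ ^ 2 - 2 * v ^ 2) * V + τ * (v ^ 2 - z * v ^ 3 - z) := by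
    rw [axisExpr]
    field_simp
    ring
  have hc : 4 * τ * (v * τ * z ^ 2) ≠ 0 := by simp [hu', ht', hτ']
  refine mul_left_cancel₀ hc ?_
  rw [mul_assoc (4 * τ) _ (axisExpr v z τ V q), e]
  linear_combination (2 * τ ^ 2 * v * z ^ 2) * h₁ - (τ ^ 2 * v * z ^ 2) * h₂
    + 2 * z ^ 2 * (2 + τ ^ 3) * h₃
    - 4 * z * ((τ + v * τ ^ 2 - 2 * v ^ 2) * V + (2 + τ ^ 3) * v ^ 2 - τ * v ^ 3 - τ) * h₄
    - 4 * τ * v ^ 2 * h₄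

end QuarterWalk

end

theorem mainTheorem2 :
    -- the complete generating function, expressed through `S(x, t)` and `S(y, t)`
    ι Q = (ι x * ι y - ι (S x) - ι (S y)) /
        (ι x * ι y - ι t * (ι x ^ 2 * ι y + ι x * ι y ^ 2 + 1)) ∧
    -- it is algebraic over `ℚ(x, y, t)`
    IsAlgebraic (MvPolynomial (Fin 3) ℚ) Q ∧
    -- the explicit form of `Q(0, 0; t)` and of `Q(u, 0; t)` for `u = x` and `u = y`
    (∃! T : PowerSeries ℚ, T = PowerSeries.X * (2 + T ^ 3)) ∧
    ∀ T : PowerSeries ℚ, T = PowerSeries.X * (2 + T ^ 3) →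
      ι (Qat 0 0) = (4 * ι (inT T) - ι (inT T) ^ 4) / (8 * ι t) ∧
      ∀ u : Ser, u = x ∨ u = y →
        (∃! V : Ser, IsSqrt (U T u) V) ∧
        ∀ V : Ser, IsSqrt (U T u) V →
          2 * ι (Qat u 0) = axisExpr (ι u) (ι t) (ι (inT T)) (ι V) (ι (Qat 0 0)) := by
  refine ⟨?_, isAlgebraic_Q, existsUnique_T, fun T hT => ⟨ι_Qat_zero_zero hT, fun u hu => ?_⟩⟩
  · have hK : ι kernel = ι x * ι y - ι t * (ι x ^ 2 * ι y + ι x * ι y ^ 2 + 1) := by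
      simp only [kernel, stepPoly, map_sub, map_mul, map_add, map_pow, map_one]
      ring
    rw [← hK, eq_div_iff (ι_ne_zero kernel_prime.ne_zero), mul_comm, ← map_mul, kernel_mul_Q_eq]
    simp only [map_sub, map_mul]
  · have hu0 : MvPowerSeries.constantCoeff u = 0 := by
      rcases hu with rfl | rfl
      exacts [constantCoeff_x, constantCoeff_y]
    have hs := isSqrt_sqrtU T hu0
    refine ⟨⟨_, hs, fun V hV => hV.unique hs⟩, fun V hV => ?_⟩
    rw [hV.unique hs]
    rcases hu with rfl | rfl
    · exact two_mul_ι_Qat hT hu0 x_ne_zero (kernel_mul_four_mul_Q_and_axes hT).2.1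
    · exact two_mul_ι_Qat hT hu0 y_ne_zero (four_mul_Qat_y_zero hT)
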